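/- Let $(\Omega,\mathbb T,\mu)$ be a $\sigma$-finite measure space whose $\sigma$-algebra $\mathbb T$ is $\mu$-complete, let $E$ be a separable real Banach space with topological dual $E^*$, and let $f_n:\Omega\times E\to[-\infty,\infty]$ $(n\in\mathbb N)$ be $\mathbb T\otimes\mathcal B(E)$-measurable functions. Let $\sigma=\sigma(E,E^*)$ be the weak topology of $E$ and $\sigma^*=\sigma(E^*,E)$ the weak-star topology of $E^*$, and write $E_\sigma=(E,\sigma)$ and $E^*_{\sigma^*}=(E^*,\sigma^*)$. Define $f:\Omega\times E\to[-\infty,\infty]$ by $$f(\omega,e)=\inf\Big\{\liminf_{n\to\infty} f_n(\omega,e_n)\;:\;(e_n)_n\subset E,\ e_n\to e \text{ weakly}\Big\},$$ and set $$f^*(\omega,e^*)=\sup_{e\in E}\big(\langle e^*,e\rangle-f(\omega,e)\big)\quad(e^*\in E^*),\qquad f^{**}(\omega,e)=\sup_{e^*\in E^*}\big(\langle e^*,e\rangle-f^*(\omega,e^*)\big)\quad(e\in E).$$ A function $g:\Omega\times X\to[-\infty,\infty]$, with $X$ a topological space, is called a normal integrand on $\Omega\times X$ if it is $\mathbb T\otimes\mathcal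 B(X)$-measurable and $g(\omega,\cdot)$ is lower semicontinuous on $X$ for every $\omega\in\Omega$. Assume that at least one of the following holds: (a) for every $\omega\in\Omega$ there are a function $h:E\to[-\infty,\infty]$ and $m\in\mathbb N$ such that $f_n(\omega,\cdot)\ge h$ for all $n\ge m$ and, for every $e^*\in E^*$ and every $r\in\mathbb R$, the set $\{e\in E: h(e)-\langle e^*,e\rangle\le r\}$ is weakly compact; (b) $E$ is reflexive. Then $f^*$ is a normal integrand on $\Omega\times E^*_{\sigma^*}$, and $f^{**}$ is a normal integrand on $\Omega\times E_\sigma$. -/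

import Mathlib

open MeasureTheory Filter Topology

noncomputable section

/-- The Fenchel-Moreau conjugate `f*(x*) = sup_x (⟨x*, x⟩ - f x)` of an extended real valued
function, as a function on the topological dual. Since `⟨x*, x⟩` is finite, the difference in
`EReal` is never of the form `∞ - ∞`. -/
def fenchelConj {X : Type*} [AddCommGroup X] [Module ℝ X] [TopologicalSpace X]
    (f : X → EReal) (xs : StrongDual ℝ X) : EReal :=
  ⨆ x : X, ((xs x : ℝ) : EReal) - f x

/-- The sequential lower epi-limit of a sequence of functions on a topological space:
the infimum of `liminf f_n(x_n)` over all sequences `(x_n)` converging to `x`. -/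
def seqLowerEpiLimit {X : Type*} [TopologicalSpace X] (f : ℕ → X → EReal) (x : X) : EReal :=
  ⨅ u : {u : ℕ → X // Tendsto u atTop (𝓝 x)}, liminf (fun n => f n (u.1 n)) atTop

/-- Normality of an integrand `f : Ω × X → [-∞, ∞]`: joint measurability with respect to the
product of the tribe of `Ω` with the Borel tribe of `X`, and lower semicontinuity of each
partial function `f(ω, ·)`. -/
def IsNormalIntegrand {Ω X : Type*} [mΩ : MeasurableSpace Ω] [TopologicalSpace X]
    (f : Ω → X → EReal) : Prop :=
  Measurable[mΩ.prod (borel X)] (fun p : Ω × X => f p.1 p.2) ∧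
    ∀ ω, LowerSemicontinuous (f ω)

section Banach

variable {E : Type*} [NormedAddCommGroup E] [NormedSpace ℝ E]

/-- `h` is inf-compact for every slope with respect to the weak topology: for every continuous
linear functional `x*`, every sublevel set of `h - ⟨x*, ·⟩` is weakly compact. -/
def IsInfWeakCompactForEverySlope (h : E → EReal) : Prop :=
  ∀ (xs : StrongDual ℝ E) (r : ℝ),
    IsCompact (toWeakSpace ℝ E '' {x : E | h x - ((xs x : ℝ) : EReal) ≤ (r : EReal)})

/-- For every `ω`, the sequence `f_n(ω, ·)` is eventually bounded below by a function that is
weakly inf-compact for every slope. -/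
def IsQuasiInfWeakCompactForEverySlope {Ω : Type*} (f : ℕ → Ω → E → EReal) : Prop :=
  ∀ ω, ∃ h : E → EReal, IsInfWeakCompactForEverySlope h ∧
    ∀ᶠ n in atTop, ∀ x, h x ≤ f n ω x

/-- The sequential lower epi-limit, for the weak topology of `E`, of the functions `f_n(ω, ·)`,
taken separately for each `ω`. -/
def weakSeqLowerEpiLimit {Ω : Type*} (f : ℕ → Ω → E → EReal) (ω : Ω) (x : E) : EReal :=
  seqLowerEpiLimit (X := WeakSpace ℝ E)
    (fun n y => f n ω ((toWeakSpace ℝ E).symm y)) (toWeakSpace ℝ E x)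

/-- The conjugate integrand `f*(ω, x*) = (f_ω)*(x*)`, on `Ω` times the dual of `E` with its
weak-star topology. -/
def conjIntegrand {Ω : Type*} (f : Ω → E → EReal) (ω : Ω) (y : WeakDual ℝ E) : EReal :=
  fenchelConj (f ω) (WeakDual.toStrongDual y)

/-- The biconjugate integrand `f**(ω, x) = (f_ω)**(x)`, restricted from the bidual to `E`
through the canonical embedding, on `Ω` times `E` with its weak topology. -/
def biconjIntegrand {Ω : Type*} (f : Ω → E → EReal) (ω : Ω) (x : WeakSpace ℝ E) : EReal :=
  fenchelConj (fenchelConj (f ω))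
    (NormedSpace.inclusionInDoubleDual ℝ E ((toWeakSpace ℝ E).symm x))

end Banach

end

/-! ### Analytic sets and measurable projection -/

section Projection

/-! The engine is the projection theorem. A strict superlevel set of a conjugate asks for the
existence of a point; approximating from a countable dense set makes it a countable union of
rectangles whose first factor is a projection, measurable since Ω is complete. The epi-limit f is
not shown to be measurable, so f* is reached through the f_n*. Always f* ≤ limsup f_n*. Under (a)
equality holds (`fenchelConj_weakSeqLowerEpiLimit_eq_limsup`): near-maximizers lie in one weakly
compact sublevel set and subconverge weakly. Under (b) the f_n cut off outside the ball of radius k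
satisfy (a), and f* is the supremum over k of the resulting conjugates, because weakly convergent
sequences are bounded. For f**, the projection runs along the balls of E*, which are weak-star
compact and metrizable. Semicontinuity is immediate: both conjugates are suprema of continuous
functions. -/

theorem isCompact_setOf_forall_le_nat (b : ℕ → ℕ) : IsCompact {x : ℕ → ℕ | ∀ i, x i ≤ b i} := by
  have : {x : ℕ → ℕ | ∀ i, x i ≤ b i} = Set.univ.pi fun i => Set.Iic (b i) := by
    ext x; simp [Pi.le_def]
  rw [this]
  exact isCompact_univ_pi fun i => (Set.finite_Iic (b i)).isCompact

/-- If `V` is an open neighbourhood in the Baire space of the box below `b`, then it contains all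
points whose first `k` coordinates are below those of `b`, for some `k`. -/
theorem exists_forall_lt_le_subset_of_isOpen {b : ℕ → ℕ} {V : Set (ℕ → ℕ)} (hV : IsOpen V)
    (hbV : {x : ℕ → ℕ | ∀ i, x i ≤ b i} ⊆ V) :
    ∃ k, {x : ℕ → ℕ | ∀ i < k, x i ≤ b i} ⊆ V := by
  let _ : MetricSpace (ℕ → ℕ) := PiNat.metricSpaceNatNat
  obtain ⟨δ, hδ, hsub⟩ := (isCompact_setOf_forall_le_nat b).exists_thickening_subset_open hV hbV
  obtain ⟨k, hk⟩ := exists_pow_lt_of_lt_one hδ (by norm_num : (1 / 2 : ℝ) < 1)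
  refine ⟨k, fun x hx => hsub ?_⟩
  rw [Metric.mem_thickening_iff]
  refine ⟨fun i => min (x i) (b i), fun i => min_le_right _ _, lt_of_le_of_lt ?_ hk⟩
  rw [← PiNat.mem_cylinder_iff_dist_le]
  intro i hi
  exact (min_eq_left (hx i hi)).symm

variable {α : Type*} [TopologicalSpace α] [MeasurableSpace α]

/-- Capacitability: bounding the coordinates in the Baire space one at a time, with loss δ k at
stage k, leaves a compact box. -/
theorem exists_isCompact_subset_range_measure_le [T2Space α] (μ : Measure α) [IsFiniteMeasure μ]
    [μ.OuterRegular] {f : (ℕ → ℕ) → α} (hf : Continuous f) {ε : ENNReal} (hε : ε ≠ 0) :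
    ∃ K ⊆ Set.range f, IsCompact K ∧ μ (Set.range f) ≤ μ K + ε := by
  obtain ⟨δ, hδ, hδε⟩ := ENNReal.exists_pos_sum_of_countable' hε ℕ
  have step : ∀ (k : ℕ) (U : Set (ℕ → ℕ)), ∃ m : ℕ,
      μ (f '' U) ≤ μ (f '' (U ∩ {x | x k ≤ m})) + δ k := by
    intro k U
    have hmono : Monotone fun m : ℕ => f '' (U ∩ {x | x k ≤ m}) := fun m n hmn =>
      Set.image_mono (Set.inter_subset_inter_right _ fun x hx => le_trans hx hmn)
    have hU : f '' U = ⋃ m : ℕ, f '' (U ∩ {x | x k ≤ m}) := by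
      rw [← Set.image_iUnion, ← Set.inter_iUnion]
      congr 1
      refine (Set.inter_eq_left.2 fun x _ => Set.mem_iUnion.2 ⟨x k, le_refl (x k)⟩).symm
    by_cases h0 : μ (f '' U) = 0
    · exact ⟨0, by simp [h0]⟩
    -- Continuity from below holds for arbitrary increasing sets, so the images need not be
    -- measurable.
    have hlt : μ (f '' U) - δ k < ⨆ m : ℕ, μ (f '' (U ∩ {x | x k ≤ m})) := by
      rw [← hmono.measure_iUnion, ← hU]
      exact ENNReal.sub_lt_self (measure_ne_top _ _) h0 (hδ k).ne'
    obtain ⟨m, hm⟩ := lt_iSup_iff.1 hlt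
    exact ⟨m, tsub_le_iff_right.1 hm.le⟩
  choose m hm using step
  let U : ℕ → Set (ℕ → ℕ) := fun k =>
    Nat.rec Set.univ (fun k V => V ∩ {x | x k ≤ m k V}) k
  have hUsucc : ∀ k, U (k + 1) = U k ∩ {x | x k ≤ m k (U k)} := fun k => rfl
  let b : ℕ → ℕ := fun k => m k (U k)
  have hU : ∀ k, U k = {x | ∀ i < k, x i ≤ b i} := by
    intro k
    induction k with
    | zero => simp [U]
    | succ k ih =>
      rw [hUsucc]
      ext x
      constructor
      · rintro ⟨h1, h2⟩ i hi
        rcases Nat.lt_succ_iff_lt_or_eq.1 hi with h | rfl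
        · rw [ih] at h1; exact h1 i h
        · exact h2
      · intro h
        exact ⟨by rw [ih]; exact fun i hi => h i (hi.trans k.lt_succ_self), h k k.lt_succ_self⟩
  have hμU : ∀ k, μ (Set.range f) ≤ μ (f '' U k) + ∑ i ∈ Finset.range k, δ i := by
    intro k
    induction k with
    | zero => simp [U]
    | succ k ih =>
      refine ih.trans ?_
      rw [Finset.sum_range_succ, hUsucc, add_comm _ (δ k), ← add_assoc]
      gcongr
      exact hm k (U k)
  refine ⟨f '' {x | ∀ i, x i ≤ b i}, Set.image_subset_range _ _, (isCompact_setOf_forall_le_nat b).image hf, ?_⟩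
  -- The sets `f '' U k` decrease, where continuity of an outer measure may fail; outer regularity
  -- and compactness of the box replace it, as some `f '' U k` already lies in O.
  have hO : ∀ O, f '' {x | ∀ i, x i ≤ b i} ⊆ O → IsOpen O → μ (Set.range f) - ε ≤ μ O := by
    intro O hO hOo
    obtain ⟨k, hk⟩ := exists_forall_lt_le_subset_of_isOpen (hOo.preimage hf) (Set.image_subset_iff.1 hO)
    rw [tsub_le_iff_right]
    refine (hμU k).trans (add_le_add (measure_mono ?_) ?_)
    · rw [hU]; exact Set.image_subset_iff.2 hk
    · exact (ENNReal.sum_le_tsum _).trans hδε.le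
  rw [← tsub_le_iff_right, Set.measure_eq_iInf_isOpen (f '' {x | ∀ i, x i ≤ b i})]
  exact le_iInf₂ fun O h => le_iInf fun h' => hO O h h'

theorem MeasureTheory.AnalyticSet.nullMeasurableSet [OpensMeasurableSpace α] [T2Space α] (μ : Measure α) [IsFiniteMeasure μ]
    [μ.OuterRegular] {s : Set α} (hs : AnalyticSet s) : NullMeasurableSet s μ := by
  rw [AnalyticSet] at hs
  rcases hs with rfl | ⟨f, hf, rfl⟩
  · exact nullMeasurableSet_empty
  have hK := fun n : ℕ => exists_isCompact_subset_range_measure_le μ hf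
    (ε := ((n : ENNReal) + 1)⁻¹) (by simp)
  choose K hKf hKc hKμ using hK
  have hKm : MeasurableSet (⋃ n, K n) := MeasurableSet.iUnion fun n => (hKc n).measurableSet
  have hle : μ (Set.range f) ≤ μ (⋃ n, K n) := by
    refine ENNReal.le_of_forall_pos_le_add fun ε hε _ => ?_
    obtain ⟨n, hn⟩ := ENNReal.exists_inv_nat_lt (ENNReal.coe_pos.2 hε).ne'
    refine (hKμ n).trans (add_le_add (measure_mono (Set.subset_iUnion _ _)) ?_)
    exact (ENNReal.inv_le_inv.2 (by simp)).trans hn.le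
  refine hKm.nullMeasurableSet.congr ?_
  exact ae_eq_of_subset_of_measure_ge (Set.iUnion_subset hKf) hle hKm.nullMeasurableSet
    (measure_ne_top _ _)

variable {Ω X : Type*} [MeasurableSpace Ω] [MeasurableSpace X]

/-- A measurable subset of a product only involves countably many measurable subsets of the first
factor, hence is pulled back from the product of the Cantor space with the second factor. -/
theorem MeasurableSet.exists_preimage_prodMap_natBool {A : Set (Ω × X)} (hA : MeasurableSet A) :
    ∃ φ : Ω → ℕ → Bool, Measurable φ ∧ ∃ B : Set ((ℕ → Bool) × X), MeasurableSet B ∧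
      A = Prod.map φ id ⁻¹' B := by
  classical
  rw [← generateFrom_prod] at hA
  induction A, hA using MeasurableSpace.generateFrom_induction with
  | hC A hA _ =>
    obtain ⟨s, hs, t, ht, rfl⟩ := hA
    refine ⟨fun ω _ => decide (ω ∈ s), measurable_pi_lambda _ fun _ => ?_,
      {x | x 0 = true} ×ˢ t, ?_, ?_⟩
    · exact measurable_to_bool (by
        convert (show MeasurableSet s from hs) using 1
        ext; simp)
    · exact (measurableSet_eq_fun (measurable_pi_apply 0) measurable_const).prod ht
    · ext; simp
  | empty => exact ⟨fun _ _ => true, measurable_const, ∅, MeasurableSet.empty, rfl⟩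
  | compl A _ ih =>
    obtain ⟨φ, hφ, B, hB, rfl⟩ := ih
    exact ⟨φ, hφ, Bᶜ, hB.compl, rfl⟩
  | iUnion A _ ih =>
    choose φ hφ B hB hAB using ih
    -- Countably many Cantor-valued maps are merged into one by pairing indices; `ψ i` recovers the
    -- i-th.
    let ψ : ℕ → (ℕ → Bool) → ℕ → Bool := fun i x j => x (Nat.pair i j)
    have hψ : ∀ i, Measurable (ψ i) := fun i =>
      measurable_pi_lambda _ fun j => measurable_pi_apply _
    refine ⟨fun ω n => φ n.unpair.1 ω n.unpair.2,
      measurable_pi_lambda _ fun n => (measurable_pi_apply _).comp (hφ _),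
      ⋃ i, Prod.map (ψ i) id ⁻¹' B i,
      MeasurableSet.iUnion fun i => ((hψ i).prodMap measurable_id) (hB i), ?_⟩
    rw [Set.preimage_iUnion]
    refine Set.iUnion_congr fun i => ?_
    rw [hAB i]
    ext ⟨ω, x⟩
    simp [ψ]

/-- **Measurable projection theorem**. -/
theorem MeasurableSet.image_fst_of_isComplete (μ : Measure Ω) [SigmaFinite μ] [μ.IsComplete]
    [StandardBorelSpace X] {A : Set (Ω × X)} (hA : MeasurableSet A) :
    MeasurableSet (Prod.fst '' A) := by
  obtain ⟨φ, hφ, B, hB, rfl⟩ := hA.exists_preimage_prodMap_natBool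
  have himg : Prod.fst '' (Prod.map φ id ⁻¹' B) = φ ⁻¹' (Prod.fst '' B) := by
    ext ω
    simp
  rw [himg]
  have hBan : AnalyticSet (Prod.fst '' B) := hB.analyticSet_image measurable_fst
  -- `μ.toFinite` is a finite measure with the null sets of μ.
  have hnull := hBan.nullMeasurableSet (μ.toFinite.map φ)
  have h2 : NullMeasurableSet (φ ⁻¹' (Prod.fst '' B)) μ.toFinite :=
    hnull.preimage ⟨hφ, Measure.AbsolutelyContinuous.rfl⟩
  exact (h2.mono_ac (absolutelyContinuous_toFinite μ)).measurable_of_complete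

end Projection

noncomputable section

/-! ### Fenchel conjugates in `EReal` -/

section Conjugate

theorem EReal.real_lt_coe_sub_iff {a c : ℝ} {y : EReal} :
    (c : EReal) < (a : EReal) - y ↔ y < ((a - c : ℝ) : EReal) := by
  induction y with
  | bot => exact iff_of_true (by simp) (EReal.bot_lt_coe _)
  | top => simp
  | coe y =>
    rw [← EReal.coe_sub, EReal.coe_lt_coe_iff, EReal.coe_lt_coe_iff]
    constructor <;> intro h <;> linarith

theorem lt_fenchelConj_iff {X : Type*} [AddCommGroup X] [Module ℝ X] [TopologicalSpace X]
    {f : X → EReal} {xs : StrongDual ℝ X} {c : ℝ} :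
    (c : EReal) < fenchelConj f xs ↔ ∃ x, f x < ((xs x - c : ℝ) : EReal) := by
  simp only [fenchelConj, lt_iSup_iff, EReal.real_lt_coe_sub_iff]

theorem fenchelConj_anti {X : Type*} [AddCommGroup X] [Module ℝ X] [TopologicalSpace X]
    {f g : X → EReal} (h : ∀ x, f x ≤ g x) (xs : StrongDual ℝ X) :
    fenchelConj g xs ≤ fenchelConj f xs :=
  iSup_mono fun x => EReal.sub_le_sub le_rfl (h x)

theorem Continuous.coe_ereal_sub_const {X : Type*} [TopologicalSpace X] {φ : X → ℝ}
    (hφ : Continuous φ) (a : EReal) : Continuous fun x => ((φ x : ℝ) : EReal) - a := by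
  induction a with
  | bot => simpa using continuous_const
  | top => simpa using continuous_const
  | coe a =>
    simp only [← EReal.coe_sub]
    exact continuous_coe_real_ereal.comp (hφ.sub continuous_const)

end Conjugate

/-! ### Weak compactness and weak convergence -/

section WeakTopology

variable {E : Type*} [NormedAddCommGroup E] [NormedSpace ℝ E]

theorem WeakSpace.continuous_eval (xs : StrongDual ℝ E) :
    Continuous fun x : WeakSpace ℝ E => xs ((toWeakSpace ℝ E).symm x) :=
  WeakBilin.eval_continuous (topDualPairing ℝ E).flip xs

/-- A separable normed space admits a sequence of continuous linear functionals separating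
points. -/
theorem exists_seq_strongDual_separating [TopologicalSpace.SeparableSpace E] :
    ∃ g : ℕ → StrongDual ℝ E, ∀ x, (∀ i, g i x = 0) → x = 0 := by
  choose g hg1 hg using fun i => exists_dual_vector'' ℝ (TopologicalSpace.denseSeq E i)
  refine ⟨g, fun x hx => ?_⟩
  by_contra hne
  have hpos : 0 < ‖x‖ := norm_pos_iff.2 hne
  obtain ⟨i, hi⟩ := (TopologicalSpace.denseRange_denseSeq E).exists_dist_lt x (half_pos hpos)
  set d := TopologicalSpace.denseSeq E i
  have h1 : ‖d‖ ≤ ‖d - x‖ := by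
    have h2 : g i (d - x) = ‖d‖ := by rw [map_sub, hx i, sub_zero, hg i]; rfl
    calc ‖d‖ = ‖g i (d - x)‖ := by rw [h2, norm_norm]
      _ ≤ ‖g i‖ * ‖d - x‖ := (g i).le_opNorm _
      _ ≤ 1 * ‖d - x‖ := by gcongr; exact hg1 i
      _ = ‖d - x‖ := one_mul _
  rw [dist_eq_norm, norm_sub_rev] at hi
  have h3 : ‖x‖ ≤ ‖d‖ + ‖d - x‖ := by
    have := norm_sub_le d (d - x)
    simpa using this
  linarith

/-- Weakly compact subsets of a separable normed space are weakly sequentially compact. -/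
theorem IsCompact.isSeqCompact_weakSpace [TopologicalSpace.SeparableSpace E]
    {K : Set (WeakSpace ℝ E)} (hK : IsCompact K) : IsSeqCompact K := by
  have : CompactSpace K := isCompact_iff_compactSpace.mp hK
  obtain ⟨g, hg⟩ := exists_seq_strongDual_separating (E := E)
  -- Countably many continuous functions separating points metrize a compact space.
  have : TopologicalSpace.MetrizableSpace K :=
    Metric.PiNatEmbed.TopologicalSpace.MetrizableSpace.of_countable_separating
      (fun n (k : K) => g n ((toWeakSpace ℝ E).symm k))
      (fun n => (WeakSpace.continuous_eval (g n)).comp continuous_subtype_val)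
      (fun x y hxy => by
        contrapose! hxy
        apply Subtype.ext
        apply (toWeakSpace ℝ E).symm.injective
        rw [← sub_eq_zero]
        exact hg _ fun i => by rw [map_sub, hxy i, sub_self])
  have hc : SeqContinuous (fun k : K => (k : WeakSpace ℝ E)) :=
    continuous_iff_seqContinuous.mp continuous_subtype_val
  simpa using IsSeqCompact.range hc

theorem isClosed_toWeakSpace_image_closedBall (x : E) (r : ℝ) :
    IsClosed (toWeakSpace ℝ E '' Metric.closedBall x r) := by
  have := (convex_closedBall x r).toWeakSpace_closure (𝕜 := ℝ)
  rw [Metric.isClosed_closedBall.closure_eq] at this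
  rw [this]
  exact isClosed_closure

theorem isCompact_toWeakSpace_image_closedBall
    (hE : Function.Surjective (NormedSpace.inclusionInDoubleDual ℝ E)) (r : ℝ) :
    IsCompact (toWeakSpace ℝ E '' Metric.closedBall 0 r) := by
  rw [← (isClosed_toWeakSpace_image_closedBall (0 : E) r).closure_eq]
  refine NormedSpace.isCompact_closure_of_isBounded ℝ E _ ?_ ?_
  · rw [Set.preimage_image_eq _ (toWeakSpace ℝ E).injective]
    exact Metric.isBounded_closedBall
  · have : Function.Surjective (NormedSpace.inclusionInDoubleDualWeak ℝ E) := fun y => by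
      obtain ⟨x, hx⟩ := hE (WeakDual.toStrongDual y)
      exact ⟨toWeakSpace ℝ E x, hx⟩
    rw [this.range_eq]
    exact Set.subset_univ _

theorem exists_norm_le_of_tendsto_weakSpace {u : ℕ → WeakSpace ℝ E} {x : WeakSpace ℝ E}
    (hu : Tendsto u atTop (𝓝 x)) : ∃ C, ∀ n, ‖(toWeakSpace ℝ E).symm (u n)‖ ≤ C := by
  obtain ⟨C, hC⟩ := banach_steinhaus
    (g := fun n => NormedSpace.inclusionInDoubleDual ℝ E ((toWeakSpace ℝ E).symm (u n)))
    (fun xs => by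
      have h1 : Tendsto (fun n => xs ((toWeakSpace ℝ E).symm (u n))) atTop
          (𝓝 (xs ((toWeakSpace ℝ E).symm x))) :=
        ((WeakSpace.continuous_eval xs).tendsto x).comp hu
      obtain ⟨C, hC⟩ := isBounded_iff_forall_norm_le.1 (Metric.isBounded_range_of_tendsto _ h1)
      exact ⟨C, fun n => hC _ ⟨n, rfl⟩⟩)
  refine ⟨C, fun n => ?_⟩
  exact ((NormedSpace.inclusionInDoubleDualLi (E := E) ℝ).norm_map _).symm.trans_le (hC n)

end WeakTopology

/-! ### Conjugate of the sequential epi-limit -/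

section EpiLimit

/-- The epi-limit tests full sequences, so a convergent subsequence has its gaps filled with the
limit. -/
theorem StrictMono.tendsto_extend_const {X : Type*} [TopologicalSpace X] {χ : ℕ → ℕ}
    (hχ : StrictMono χ) {v : ℕ → X} {a : X} (hv : Tendsto v atTop (𝓝 a)) :
    Tendsto (Function.extend χ v fun _ => a) atTop (𝓝 a) := by
  rw [tendsto_def] at hv ⊢
  intro U hU
  obtain ⟨N, hN⟩ := mem_atTop_sets.1 (hv U hU)
  refine mem_atTop_sets.2 ⟨χ N, fun m hm => ?_⟩
  by_cases h : ∃ k, χ k = m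
  · obtain ⟨k, rfl⟩ := h
    rw [Set.mem_preimage, hχ.injective.extend_apply]
    exact hN k (hχ.le_iff_le.1 hm)
  · rw [Set.mem_preimage, Function.extend_apply' _ _ _ h]
    exact mem_of_mem_nhds hU

variable {Ω E : Type*} [NormedAddCommGroup E] [NormedSpace ℝ E]

theorem weakSeqLowerEpiLimit_lt_iff {f : ℕ → Ω → E → EReal} {ω : Ω} {x : E} {a : EReal} :
    weakSeqLowerEpiLimit f ω x < a ↔ ∃ u : ℕ → WeakSpace ℝ E,
      Tendsto u atTop (𝓝 (toWeakSpace ℝ E x)) ∧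
        liminf (fun n => f n ω ((toWeakSpace ℝ E).symm (u n))) atTop < a := by
  simp only [weakSeqLowerEpiLimit, seqLowerEpiLimit, iInf_lt_iff, Subtype.exists, exists_prop]

theorem fenchelConj_weakSeqLowerEpiLimit_le (f : ℕ → Ω → E → EReal) (ω : Ω)
    (xs : StrongDual ℝ E) :
    fenchelConj (weakSeqLowerEpiLimit f ω) xs ≤
      limsup (fun n => fenchelConj (f n ω) xs) atTop := by
  rw [← EReal.ge_of_forall_gt_iff_ge]
  intro c hc
  obtain ⟨x, hx⟩ := lt_fenchelConj_iff.1 hc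
  obtain ⟨u, hu, hlim⟩ := weakSeqLowerEpiLimit_lt_iff.1 hx
  obtain ⟨d, hd1, hd2⟩ := EReal.lt_iff_exists_real_btwn.1 hlim
  rw [EReal.coe_lt_coe_iff] at hd2
  have hev : ∀ᶠ n in atTop, d + c < xs ((toWeakSpace ℝ E).symm (u n)) :=
    (((WeakSpace.continuous_eval xs).tendsto _).comp hu).eventually_const_lt
      (by simp only [LinearEquiv.symm_apply_apply]; linarith)
  refine le_limsup_of_frequently_le ?_
  refine ((frequently_lt_of_liminf_lt (by isBoundedDefault) hd1).and_eventually hev).mono ?_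
  rintro n ⟨h1, h2⟩
  refine (lt_fenchelConj_iff.2 ⟨_, h1.trans ?_⟩).le
  rw [EReal.coe_lt_coe_iff]
  linarith

theorem fenchelConj_weakSeqLowerEpiLimit_eq_limsup [TopologicalSpace.SeparableSpace E]
    {f : ℕ → Ω → E → EReal} (hf : IsQuasiInfWeakCompactForEverySlope f) (ω : Ω)
    (xs : StrongDual ℝ E) :
    fenchelConj (weakSeqLowerEpiLimit f ω) xs =
      limsup (fun n => fenchelConj (f n ω) xs) atTop := by
  refine le_antisymm (fenchelConj_weakSeqLowerEpiLimit_le f ω xs) ?_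
  rw [← EReal.ge_of_forall_gt_iff_ge]
  intro c hc
  obtain ⟨h, hh, hle⟩ := hf ω
  obtain ⟨φ, hφ, hφP⟩ := extraction_of_frequently_atTop
    ((frequently_lt_of_lt_limsup (by isBoundedDefault) hc).and_eventually hle)
  choose e he using fun n => lt_fenchelConj_iff.1 (hφP n).1
  -- The level -c comes from h(e_n) ≤ f_{φ n}(e_n) < ⟨x*, e_n⟩ - c.
  have hK : ∀ n, toWeakSpace ℝ E (e n) ∈
      toWeakSpace ℝ E '' {x : E | h x - ((xs x : ℝ) : EReal) ≤ ((-c : ℝ) : EReal)} := by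
    intro n
    refine Set.mem_image_of_mem _ ?_
    have h1 : h (e n) ≤ ((-c : ℝ) : EReal) + ((xs (e n) : ℝ) : EReal) := by
      refine (((hφP n).2 (e n)).trans (he n).le).trans_eq ?_
      rw [← EReal.coe_add, sub_eq_neg_add]
    exact EReal.sub_le_of_le_add h1
  obtain ⟨a, -, ψ, hψ, hlim⟩ := (hh xs (-c)).isSeqCompact_weakSpace hK
  set χ := φ ∘ ψ
  have hχ : StrictMono χ := hφ.comp hψ
  set u := Function.extend χ ((fun n => toWeakSpace ℝ E (e n)) ∘ ψ) fun _ => a with hu_def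
  have hu : Tendsto u atTop (𝓝 a) := hχ.tendsto_extend_const hlim
  have hfa : weakSeqLowerEpiLimit f ω ((toWeakSpace ℝ E).symm a) ≤
      ((xs ((toWeakSpace ℝ E).symm a) - c : ℝ) : EReal) := by
    rw [← EReal.le_of_forall_lt_iff_le]
    intro d hd
    rw [EReal.coe_lt_coe_iff] at hd
    refine (iInf_le _ ⟨u, by simpa using hu⟩).trans ?_
    refine liminf_le_of_frequently_le ?_
    have hev : ∀ᶠ k in atTop, xs (e (ψ k)) - c < d :=
      ((((WeakSpace.continuous_eval xs).tendsto _).comp hlim).sub_const c).eventually_lt_const hd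
    refine hχ.tendsto_atTop.frequently (hev.mono fun k hk => ?_).frequently
    have huk : u (χ k) = toWeakSpace ℝ E (e (ψ k)) := hχ.injective.extend_apply _ _ _
    simp only [huk, LinearEquiv.symm_apply_apply]
    exact (he (ψ k)).le.trans (EReal.coe_le_coe_iff.2 hk.le)
  refine le_trans ?_ (le_iSup _ ((toWeakSpace ℝ E).symm a))
  refine le_trans ?_ (EReal.sub_le_sub le_rfl hfa)
  rw [← EReal.coe_sub, sub_sub_cancel]

/-- The restriction of an extended real valued function to the closed ball of radius `r`,
extended by `⊤`. -/
def ballTrunc {E : Type*} [NormedAddCommGroup E] (r : ℝ) (g : E → EReal) (x : E) : EReal :=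
  open Classical in if ‖x‖ ≤ r then g x else ⊤

theorem le_ballTrunc {E : Type*} [NormedAddCommGroup E] (r : ℝ) (g : E → EReal) (x : E) : g x ≤ ballTrunc r g x := by
  unfold ballTrunc
  split_ifs <;> simp

/-- The minorant is -∞ on the ball and +∞ off it, so each of its tilted sublevel sets is the whole
ball. -/
theorem isQuasiInfWeakCompactForEverySlope_ballTrunc
    (hE : Function.Surjective (NormedSpace.inclusionInDoubleDual ℝ E)) (r : ℝ)
    (f : ℕ → Ω → E → EReal) :
    IsQuasiInfWeakCompactForEverySlope fun n ω => ballTrunc r (f n ω) := by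
  intro ω
  refine ⟨ballTrunc r fun _ => ⊥, fun xs c => ?_, Eventually.of_forall fun n x => ?_⟩
  · convert isCompact_toWeakSpace_image_closedBall hE r using 2
    ext x
    by_cases hx : ‖x‖ ≤ r <;> simp [ballTrunc, hx]
  · by_cases hx : ‖x‖ ≤ r <;> simp [ballTrunc, hx]

theorem fenchelConj_weakSeqLowerEpiLimit_eq_iSup_ballTrunc (f : ℕ → Ω → E → EReal) (ω : Ω)
    (xs : StrongDual ℝ E) :
    fenchelConj (weakSeqLowerEpiLimit f ω) xs = ⨆ k : ℕ,
      fenchelConj (weakSeqLowerEpiLimit (fun n ω => ballTrunc (k : ℝ) (f n ω)) ω) xs := by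
  refine le_antisymm ?_ (iSup_le fun k => fenchelConj_anti (fun x => ?_) xs)
  · rw [← EReal.ge_of_forall_gt_iff_ge]
    intro c hc
    obtain ⟨x, hx⟩ := lt_fenchelConj_iff.1 hc
    obtain ⟨u, hu, hlim⟩ := weakSeqLowerEpiLimit_lt_iff.1 hx
    obtain ⟨C, hC⟩ := exists_norm_le_of_tendsto_weakSpace hu
    obtain ⟨k, hk⟩ := exists_nat_ge C
    refine le_trans (lt_fenchelConj_iff.2 ⟨x, weakSeqLowerEpiLimit_lt_iff.2 ⟨u, hu, ?_⟩⟩).le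
      (le_iSup (fun k : ℕ => fenchelConj
        (weakSeqLowerEpiLimit (fun n ω => ballTrunc (k : ℝ) (f n ω)) ω) xs) k)
    convert hlim using 4 with n
    exact if_pos ((hC n).trans hk)
  · exact iInf_mono fun u => liminf_le_liminf (Eventually.of_forall fun n => le_ballTrunc _ _ _)

end EpiLimit
end

noncomputable section

/-! ### Joint measurability and semicontinuity of the conjugates -/

section Measurability

theorem measurable_of_measurableSet_real_lt {S : Type*} [MeasurableSpace S] {g : S → EReal}
    (hg : ∀ c : ℝ, MeasurableSet {s | (c : EReal) < g s}) : Measurable g := by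
  refine measurable_of_Ioi fun a => ?_
  have : g ⁻¹' Set.Ioi a = ⋃ (q : ℚ) (_ : a < ((q : ℝ) : EReal)), {s | ((q : ℝ) : EReal) < g s} := by
    ext s
    simp only [Set.mem_preimage, Set.mem_Ioi, Set.mem_iUnion, Set.mem_ofPred_eq, exists_prop]
    exact EReal.lt_iff_exists_rat_btwn
  rw [this]
  exact MeasurableSet.iUnion fun q => MeasurableSet.iUnion fun _ => hg q

variable {Ω E : Type*} [MeasurableSpace Ω] [NormedAddCommGroup E] [NormedSpace ℝ E]

theorem WeakDual.measurable_norm [MeasurableSpace (WeakDual ℝ E)]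
    [OpensMeasurableSpace (WeakDual ℝ E)] :
    Measurable fun y : WeakDual ℝ E => ‖WeakDual.toStrongDual y‖ := by
  refine measurable_of_Iic fun r => ?_
  have : (fun y : WeakDual ℝ E => ‖WeakDual.toStrongDual y‖) ⁻¹' Set.Iic r =
      WeakDual.toStrongDual ⁻¹' Metric.closedBall (0 : StrongDual ℝ E) r := by
    ext y
    simp
  rw [this]
  exact (WeakDual.isClosed_closedBall 0 r).measurableSet

theorem exists_nat_div_succ_lt (a : ℝ) {δ : ℝ} (hδ : 0 < δ) :
    ∃ m : ℕ, a * (1 / ((m : ℝ) + 1)) < δ := by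
  obtain ⟨m, hm⟩ := exists_nat_gt (a / δ)
  refine ⟨m, ?_⟩
  rw [div_lt_iff₀ hδ] at hm
  rw [mul_one_div, div_lt_iff₀ (by positivity)]
  linarith

open TopologicalSpace in
/-- The conjugate of a measurable integrand on a separable Banach space is jointly measurable. -/
theorem measurable_conjIntegrand [CompleteSpace E] [SeparableSpace E] [MeasurableSpace E]
    [BorelSpace E] (μ : Measure Ω) [SigmaFinite μ] [μ.IsComplete]
    [MeasurableSpace (WeakDual ℝ E)] [BorelSpace (WeakDual ℝ E)] {f : Ω → E → EReal}
    (hf : Measurable fun p : Ω × E => f p.1 p.2) :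
    Measurable fun p : Ω × WeakDual ℝ E => conjIntegrand f p.1 p.2 := by
  have : SecondCountableTopology E := UniformSpace.secondCountable_of_separable E
  refine measurable_of_measurableSet_real_lt fun c => ?_
  -- The rational q and the dense point decouple ω from y. Moving between x and the dense point
  -- costs at most ‖y‖/(m+1) each way, hence the factor 2 in the choice of m.
  have hset : {p : Ω × WeakDual ℝ E | (c : EReal) < conjIntegrand f p.1 p.2} =
      ⋃ (i : ℕ) (m : ℕ) (q : ℚ),
        (Prod.fst '' {p : Ω × E | dist p.2 (denseSeq E i) < 1 / ((m : ℝ) + 1) ∧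
          f p.1 p.2 < ((q : ℝ) : EReal)}) ×ˢ
        {y : WeakDual ℝ E | (q : ℝ) + ‖WeakDual.toStrongDual y‖ * (1 / ((m : ℝ) + 1)) ≤
          y (denseSeq E i) - c} := by
    ext ⟨ω, y⟩
    simp only [conjIntegrand, Set.mem_ofPred_eq, lt_fenchelConj_iff, Set.mem_iUnion, Set.mem_prod,
      Set.mem_image, Prod.exists, exists_and_right, exists_eq_right]
    have hdist : ∀ a b : E, y a ≤ y b + ‖WeakDual.toStrongDual y‖ * dist a b := by
      intro a b
      have h := (WeakDual.toStrongDual y).le_opNorm (a - b)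
      rw [map_sub, Real.norm_eq_abs, ← dist_eq_norm] at h
      have h' := (le_abs_self _).trans h
      simp only [WeakDual.toStrongDual_apply] at h'
      linarith
    constructor
    · rintro ⟨x, hx⟩
      obtain ⟨q, hq1, hq2⟩ := EReal.lt_iff_exists_rat_btwn.1 hx
      rw [EReal.coe_lt_coe_iff, WeakDual.toStrongDual_apply] at hq2
      obtain ⟨m, hm⟩ := exists_nat_div_succ_lt (2 * ‖WeakDual.toStrongDual y‖) (sub_pos.2 hq2)
      obtain ⟨i, hi⟩ := (denseRange_denseSeq E).exists_dist_lt x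
        (show (0 : ℝ) < 1 / ((m : ℝ) + 1) by positivity)
      refine ⟨i, m, q, ⟨x, hi, hq1⟩, ?_⟩
      have h1 := hdist x (denseSeq E i)
      have h2 := mul_le_mul_of_nonneg_left hi.le (norm_nonneg (WeakDual.toStrongDual y))
      linarith
    · rintro ⟨i, m, q, ⟨x, hi, hq1⟩, hq2⟩
      refine ⟨x, hq1.trans_le (EReal.coe_le_coe_iff.2 ?_)⟩
      rw [WeakDual.toStrongDual_apply]
      have h1 := hdist (denseSeq E i) x
      rw [dist_comm] at h1
      have h2 := mul_le_mul_of_nonneg_left hi.le (norm_nonneg (WeakDual.toStrongDual y))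
      linarith
  rw [hset]
  refine MeasurableSet.iUnion fun i => MeasurableSet.iUnion fun m => MeasurableSet.iUnion fun q =>
    MeasurableSet.prod (MeasurableSet.image_fst_of_isComplete μ ?_) ?_
  · exact (measurableSet_lt (measurable_snd.dist measurable_const) measurable_const).inter
      (measurableSet_lt hf measurable_const)
  · exact measurableSet_le ((WeakDual.measurable_norm.mul_const _).const_add _)
      ((WeakDual.eval_continuous _).measurable.sub_const c)

theorem standardBorelSpace_weakDual_closedBall [TopologicalSpace.SeparableSpace E]
    [MeasurableSpace (WeakDual ℝ E)] [BorelSpace (WeakDual ℝ E)] (r : ℝ) :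
    StandardBorelSpace
      (WeakDual.toStrongDual ⁻¹' Metric.closedBall (0 : StrongDual ℝ E) r) := by
  have hK := WeakDual.isCompact_closedBall (0 : StrongDual ℝ E) r
  have := isCompact_iff_compactSpace.mp hK
  have := WeakDual.metrizable_of_isCompact ℝ E _ hK
  let _ := TopologicalSpace.metrizableSpaceMetric
    (WeakDual.toStrongDual ⁻¹' Metric.closedBall (0 : StrongDual ℝ E) r)
  infer_instance

theorem measurableSet_image_fst_closedBall_lt [TopologicalSpace.SeparableSpace E] (μ : Measure Ω)
    [SigmaFinite μ] [μ.IsComplete] [MeasurableSpace (WeakDual ℝ E)] [BorelSpace (WeakDual ℝ E)]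
    {g : Ω → WeakDual ℝ E → EReal} (hg : Measurable fun p : Ω × WeakDual ℝ E => g p.1 p.2)
    (r : ℝ) (x : E) (c d : ℝ) :
    MeasurableSet (Prod.fst '' {p : Ω ×
      (WeakDual.toStrongDual ⁻¹' Metric.closedBall (0 : StrongDual ℝ E) r : Set (WeakDual ℝ E)) |
        g p.1 p.2 < (((p.2 : WeakDual ℝ E) x - c - d : ℝ) : EReal)}) := by
  have := standardBorelSpace_weakDual_closedBall (E := E) r
  have hlt : MeasurableSet {p : Ω × WeakDual ℝ E | g p.1 p.2 < ((p.2 x - c - d : ℝ) : EReal)} :=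
    measurableSet_lt hg ((((WeakDual.eval_continuous x).measurable.comp
      measurable_snd).sub_const c).sub_const d).coe_real_ereal
  exact MeasurableSet.image_fst_of_isComplete μ
    ((measurable_id.prodMap measurable_subtype_coe) hlt)

open TopologicalSpace in
/-- If the conjugate integrand is jointly measurable, so is the biconjugate integrand. -/
theorem measurable_biconjIntegrand [SeparableSpace E] (μ : Measure Ω) [SigmaFinite μ]
    [μ.IsComplete] [MeasurableSpace (WeakDual ℝ E)] [BorelSpace (WeakDual ℝ E)]
    [MeasurableSpace (WeakSpace ℝ E)] [BorelSpace (WeakSpace ℝ E)] {f : Ω → E → EReal}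
    (hf : Measurable fun p : Ω × WeakDual ℝ E => conjIntegrand f p.1 p.2) :
    Measurable fun p : Ω × WeakSpace ℝ E => biconjIntegrand f p.1 p.2 := by
  refine measurable_of_measurableSet_real_lt fun c => ?_
  let B : ℕ → Set (WeakDual ℝ E) := fun k =>
    WeakDual.toStrongDual ⁻¹' Metric.closedBall (0 : StrongDual ℝ E) k
  -- Restricting y to the ball of radius k gives a standard Borel space to project along and a
  -- uniform Lipschitz constant k. Norm balls in E are weakly closed by convexity, so the second
  -- factor is weakly Borel.
  have hset : {p : Ω × WeakSpace ℝ E | (c : EReal) < biconjIntegrand f p.1 p.2} =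
      ⋃ (k : ℕ) (j : ℕ) (m : ℕ),
        (Prod.fst '' {p : Ω × B k | conjIntegrand f p.1 p.2 <
          (((p.2 : WeakDual ℝ E) (denseSeq E j) - c - k * (1 / ((m : ℝ) + 1)) : ℝ) : EReal)}) ×ˢ
        (toWeakSpace ℝ E '' Metric.closedBall (denseSeq E j) (1 / ((m : ℝ) + 1))) := by
    ext ⟨ω, x⟩
    obtain ⟨x, rfl⟩ := (toWeakSpace ℝ E).surjective x
    simp only [biconjIntegrand, Set.mem_ofPred_eq, lt_fenchelConj_iff, Set.mem_iUnion, Set.mem_prod,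
      Set.mem_image, Prod.exists, exists_and_right, exists_eq_right,
      (toWeakSpace ℝ E).injective.eq_iff, Metric.mem_closedBall, NormedSpace.dual_def,
      LinearEquiv.symm_apply_apply]
    have hdist : ∀ (k : ℕ) (y : StrongDual ℝ E), ‖y‖ ≤ k → ∀ a b : E, y a ≤ y b + k * dist a b := by
      intro k y hy a b
      have h := y.le_of_opNorm_le hy (a - b)
      rw [map_sub, Real.norm_eq_abs, ← dist_eq_norm] at h
      have h' := (le_abs_self _).trans h
      linarith
    constructor
    · rintro ⟨y, hy⟩
      obtain ⟨d, hd1, hd2⟩ := EReal.lt_iff_exists_real_btwn.1 hy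
      rw [EReal.coe_lt_coe_iff] at hd2
      obtain ⟨k, hk⟩ := exists_nat_ge ‖y‖
      obtain ⟨m, hm⟩ := exists_nat_div_succ_lt (2 * (k : ℝ)) (sub_pos.2 hd2)
      obtain ⟨j, hj⟩ := (denseRange_denseSeq E).exists_dist_lt x
        (show (0 : ℝ) < 1 / ((m : ℝ) + 1) by positivity)
      refine ⟨k, j, m, ⟨⟨StrongDual.toWeakDual y, by simpa [B] using hk⟩,
        hd1.trans_le (EReal.coe_le_coe_iff.2 ?_)⟩, hj.le⟩
      have h1 := hdist k y hk x (denseSeq E j)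
      have h2 := mul_le_mul_of_nonneg_left hj.le (Nat.cast_nonneg (α := ℝ) k)
      rw [StrongDual.toWeakDual_apply]
      linarith
    · rintro ⟨k, j, m, ⟨⟨y, hyk⟩, hy⟩, hj⟩
      refine ⟨WeakDual.toStrongDual y, lt_of_lt_of_le hy (EReal.coe_le_coe_iff.2 ?_)⟩
      have h1 := hdist k (WeakDual.toStrongDual y) (by simpa [B] using hyk) (denseSeq E j) x
      rw [dist_comm] at h1
      have h2 := mul_le_mul_of_nonneg_left hj (Nat.cast_nonneg (α := ℝ) k)
      simp only [WeakDual.toStrongDual_apply] at h1 ⊢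
      linarith
  rw [hset]
  refine MeasurableSet.iUnion fun k => MeasurableSet.iUnion fun j => MeasurableSet.iUnion fun m =>
    MeasurableSet.prod ?_ (isClosed_toWeakSpace_image_closedBall _ _).measurableSet
  exact measurableSet_image_fst_closedBall_lt μ hf _ _ _ _

theorem lowerSemicontinuous_conjIntegrand {Ω : Type*} (f : Ω → E → EReal) (ω : Ω) :
    LowerSemicontinuous (conjIntegrand f ω) :=
  lowerSemicontinuous_iSup fun x =>
    ((WeakDual.eval_continuous x).coe_ereal_sub_const (f ω x)).lowerSemicontinuous

theorem lowerSemicontinuous_biconjIntegrand {Ω : Type*} (f : Ω → E → EReal) (ω : Ω) :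
    LowerSemicontinuous (biconjIntegrand f ω) :=
  lowerSemicontinuous_iSup fun xs =>
    ((WeakSpace.continuous_eval xs).coe_ereal_sub_const _).lowerSemicontinuous

theorem measurable_ballTrunc {E : Type*} [NormedAddCommGroup E] [MeasurableSpace E] [BorelSpace E] {f : Ω → E → EReal}
    (hf : Measurable fun p : Ω × E => f p.1 p.2) (r : ℝ) :
    Measurable fun p : Ω × E => ballTrunc r (f p.1) p.2 :=
  Measurable.ite (measurableSet_le measurable_snd.norm measurable_const) hf measurable_const

theorem measurable_conjIntegrand_weakSeqLowerEpiLimit [CompleteSpace E]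
    [TopologicalSpace.SeparableSpace E] [MeasurableSpace E] [BorelSpace E] (μ : Measure Ω)
    [SigmaFinite μ] [μ.IsComplete] [MeasurableSpace (WeakDual ℝ E)] [BorelSpace (WeakDual ℝ E)]
    {f : ℕ → Ω → E → EReal} (hf : ∀ n, Measurable fun p : Ω × E => f n p.1 p.2)
    (h : IsQuasiInfWeakCompactForEverySlope f) :
    Measurable fun p : Ω × WeakDual ℝ E => conjIntegrand (weakSeqLowerEpiLimit f) p.1 p.2 := by
  simp only [conjIntegrand, fenchelConj_weakSeqLowerEpiLimit_eq_limsup h]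
  exact Measurable.limsup fun n => measurable_conjIntegrand μ (hf n)

end Measurability

end

theorem theorem4p1 {Ω : Type*} [MeasurableSpace Ω] (μ : Measure Ω) [SigmaFinite μ]
    [μ.IsComplete]
    {E : Type*} [NormedAddCommGroup E] [NormedSpace ℝ E] [CompleteSpace E]
    [TopologicalSpace.SeparableSpace E] [MeasurableSpace E] [BorelSpace E]
    (f : ℕ → Ω → E → EReal)
    (hf : ∀ n, Measurable (fun p : Ω × E => f n p.1 p.2))
    (h : IsQuasiInfWeakCompactForEverySlope f ∨
      Function.Surjective (NormedSpace.inclusionInDoubleDual ℝ E)) :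
    IsNormalIntegrand (conjIntegrand (weakSeqLowerEpiLimit f)) ∧
      IsNormalIntegrand (biconjIntegrand (weakSeqLowerEpiLimit f)) := by
  let _ : MeasurableSpace (WeakDual ℝ E) := borel _
  have : BorelSpace (WeakDual ℝ E) := ⟨rfl⟩
  let _ : MeasurableSpace (WeakSpace ℝ E) := borel _
  have : BorelSpace (WeakSpace ℝ E) := ⟨rfl⟩
  have hconj : Measurable fun p : Ω × WeakDual ℝ E =>
      conjIntegrand (weakSeqLowerEpiLimit f) p.1 p.2 := by
    rcases h with h | hE
    · exact measurable_conjIntegrand_weakSeqLowerEpiLimit μ hf h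
    · have heq : ∀ p : Ω × WeakDual ℝ E, conjIntegrand (weakSeqLowerEpiLimit f) p.1 p.2 =
          ⨆ k : ℕ, conjIntegrand
            (weakSeqLowerEpiLimit fun n ω => ballTrunc (k : ℝ) (f n ω)) p.1 p.2 :=
        fun p => fenchelConj_weakSeqLowerEpiLimit_eq_iSup_ballTrunc f p.1 _
      simp only [heq]
      exact Measurable.iSup fun k => measurable_conjIntegrand_weakSeqLowerEpiLimit μ
        (fun n => measurable_ballTrunc (hf n) k)
        (isQuasiInfWeakCompactForEverySlope_ballTrunc hE k f)
  exact ⟨⟨hconj, lowerSemicontinuous_conjIntegrand _⟩,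
    measurable_biconjIntegrand μ hconj, lowerSemicontinuous_biconjIntegrand _⟩
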